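/- Let $(\Omega,\mathscr A,P)$ be a complete probability space without atoms (every $S\in\mathscr A$ with $P(S)>0$ contains some $T\in\mathscr A$ with $0<P(T)<P(S)$), and let $\mathbb E$ be a real, not necessarily separable, Banach space. Let $\mathfrak C(\mathbb E)$ (resp. $\mathfrak C_c(\mathbb E)$) be the space of all nonempty bounded closed (resp. nonempty bounded closed convex) subsets of $\mathbb E$, with the Pompeiu–Hausdorff metric $h$, and put $\|A\|=\sup_{x\in A}\|x\|$. For $\mathcal K=\mathfrak C(\mathbb E)$ or $\mathfrak C_c(\mathbb E)$, a map $G:\Omega\to\mathcal K$ is countably-valued if there are sets $A_i\in\mathcal K$ and a countable measurable partition $\{\Omega_i\}$ of $\Omega$ (empty pieces allowed) with $G=A_i$ on $\Omega_i$; such data form a representation of $G$. Let $\mathbb Z^1(\Omega,\mathcal K)$ be the set of countably-valued $G:\Omega\to\mathcal K$ with $\int_\Omega\|G\|\,dP<\infty$, and $\mathbb L^1(\Omega,\mathcal K)$ the set of $F:\Omega\to\mathcal K$ with $\int_\Omega\|F\|\,dP<\infty$ that are strongly measurable, i.e. for which there are countably-valued $G_n:\Omega\to\mathcal K$ converging to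 $F$ uniformly a.s., meaning $\operatorname{ess\,sup}_{\omega\in\Omega} h(G_n(\omega),F(\omega))\to 0$. For $F\in\mathbb L^1(\Omega,\mathfrak C(\mathbb E))$ the Aumann integral, also called the expectation $E(F)$ of $F$, is $$(\mathrm A)\!\int_\Omega F\,dP=\overline{\Big\{\int_\Omega f\,dP \;:\; f:\Omega\to\mathbb E \text{ Bochner integrable},\ f(\omega)\in F(\omega)\text{ for all }\omega\in\Omega\Big\}}.$$ For $G\in\mathbb Z^1(\Omega,\mathfrak C_c(\mathbb E))$ the Hukuhara integral is $(\mathrm H)\!\int_\Omega G\,dP=\sum_{i} P(\Omega_i)A_i$, the $h$-limit in $\mathfrak C_c(\mathbb E)$ of the closures of the partial Minkowski sums, for any representation of $G$. For $F\in\mathbb L^1(\Omega,\mathfrak C_c(\mathbb E))$ it is the set $(\mathrm H)\!\int_\Omega F\,dP\in\mathfrak C_c(\mathbb E)$ that is the $h$-limit of $(\mathrm H)\!\int_\Omega G_n\,dP$ for any sequence $G_n\in\mathbb Z^1(\Omega,\mathfrak C_c(\mathbb E))$ converging to $F$ uniformly a.s. Finally, $(\overline{\mathrm{co}}F)(\omega)$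 is the closed convex hull of $F(\omega)$. Then for each $F\in\mathbb L^1(\Omega,\mathfrak C(\mathbb E))$: $\overline{\mathrm{co}}F\in\mathbb L^1(\Omega,\mathfrak C_c(\mathbb E))$, the Hukuhara integral of $\overline{\mathrm{co}}F$ exists (sequences as above exist, and the limits exist and do not depend on the representations or on the sequence), and $$(\mathrm A)\!\int_\Omega F\,dP=(\mathrm H)\!\int_\Omega(\overline{\mathrm{co}}F)\,dP .$$ Consequently $E(F)=(\mathrm H)\!\int_\Omega(\overline{\mathrm{co}}F)\,dP$, and $E(F)$ is a nonempty bounded closed convex subset of $\mathbb E$. -/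

import Mathlib

open MeasureTheory Filter Topology
open scoped ENNReal Pointwise

noncomputable section

namespace RandomSets

/-- A measure is atomless if every measurable set of positive measure contains a measurable
subset of strictly smaller positive measure. -/
def Atomless {Ω : Type*} [MeasurableSpace Ω] (P : Measure Ω) : Prop :=
  ∀ S : Set Ω, MeasurableSet S → 0 < P S →
    ∃ T : Set Ω, T ⊆ S ∧ MeasurableSet T ∧ 0 < P T ∧ P T < P S

/-- The space `ℭ(E)` of nonempty bounded closed subsets of `E`. -/
def BddClosedSets (E : Type*) [NormedAddCommGroup E] : Set (Set E) :=
  {A | A.Nonempty ∧ IsClosed A ∧ Bornology.IsBounded A}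

/-- The space `ℭ_c(E)` of nonempty bounded closed convex subsets of `E`. -/
def BddClosedConvexSets (E : Type*) [NormedAddCommGroup E] [NormedSpace ℝ E] : Set (Set E) :=
  {A | A ∈ BddClosedSets E ∧ Convex ℝ A}

theorem limit_unique {E : Type*} [NormedAddCommGroup E] {D : ℕ → Set E} {C C' : Set E} (hC : IsClosed C) (hC' : IsClosed C')
    (h : Tendsto (fun n => Metric.hausdorffEDist (D n) C) atTop (𝓝 0))
    (h' : Tendsto (fun n => Metric.hausdorffEDist (D n) C') atTop (𝓝 0)) : C = C' := by
  refine (hC.hausdorffEDist_zero_iff hC').1 (le_antisymm ?_ bot_le)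
  have hs := h.add h'
  rw [add_zero] at hs
  refine ge_of_tendsto' hs fun n => ?_
  have := Metric.hausdorffEDist_triangle (s := C) (t := D n) (u := C')
  rwa [Metric.hausdorffEDist_comm (s := C) (t := D n)] at this

section

variable {Ω E : Type*} [MeasurableSpace Ω] [NormedAddCommGroup E] [NormedSpace ℝ E]

/-- `‖A‖ = sup {‖x‖ | x ∈ A}`, with values in `[0, ∞]`. -/
def setNorm (A : Set E) : ℝ≥0∞ := ⨆ x ∈ A, ‖x‖ₑ

/-- `G(ω) = ∑ A_i χ_{T_i}(ω)`, where the `A_i` belong to the class `K` of sets and the `T_i` form a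
countable measurable partition of `Ω` (some pieces may be empty). -/
structure IsRepresentation (K : Set (Set E)) (G : Ω → Set E) (A : ℕ → Set E) (T : ℕ → Set Ω) :
    Prop where
  value_mem : ∀ i, A i ∈ K
  measurable : ∀ i, MeasurableSet (T i)
  disjoint : ∀ i j, i ≠ j → Disjoint (T i) (T j)
  cover : ⋃ i, T i = Set.univ
  eq_on : ∀ i, ∀ ω ∈ T i, G ω = A i

/-- `G` is a countably-valued map with values in `K`. -/
def IsCountablyValued (K : Set (Set E)) (G : Ω → Set E) : Prop :=
  ∃ (A : ℕ → Set E) (T : ℕ → Set Ω), IsRepresentation K G A T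

/-- The essential supremum over `Ω` of the Pompeiu-Hausdorff distance `h(G(ω), F(ω))`. -/
def essHausdorff (P : Measure Ω) (G F : Ω → Set E) : ℝ≥0∞ :=
  essSup (fun ω => Metric.hausdorffEDist (G ω) (F ω)) P

/-- `F` is strongly measurable: a uniform a.s. limit of countably-valued maps into `K`. -/
def IsStronglyMeasurable (P : Measure Ω) (K : Set (Set E)) (F : Ω → Set E) : Prop :=
  ∃ G : ℕ → Ω → Set E, (∀ n, IsCountablyValued K (G n)) ∧
    Tendsto (fun n => essHausdorff P (G n) F) atTop (𝓝 0)

/-- `𝕃¹(Ω, K)`: the strongly measurable, integrable maps `F : Ω → K`. -/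
structure MemL1 (P : Measure Ω) (K : Set (Set E)) (F : Ω → Set E) : Prop where
  value_mem : ∀ ω, F ω ∈ K
  stronglyMeasurable : IsStronglyMeasurable P K F
  integrable : ∫⁻ ω, setNorm (F ω) ∂P < ∞

/-- `ℤ¹(Ω, K)`: the countably-valued, integrable maps `G : Ω → K`. -/
structure MemZ1 (P : Measure Ω) (K : Set (Set E)) (G : Ω → Set E) : Prop where
  countablyValued : IsCountablyValued K G
  integrable : ∫⁻ ω, setNorm (G ω) ∂P < ∞

/-- `S¹_F`: the Bochner integrable selectors of `F`. For `F ∈ 𝕃¹(Ω, ℭ(E))` every (Bochner)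
measurable selector is integrable, as `‖f(ω)‖ ≤ ‖F(ω)‖`. -/
def selectors (P : Measure Ω) (F : Ω → Set E) : Set (Ω → E) :=
  {f | Integrable f P ∧ ∀ ω, f ω ∈ F ω}

/-- The Aumann integral: the closure of the set of integrals of the selectors of `F`. -/
def aumannIntegral (P : Measure Ω) (F : Ω → Set E) : Set E :=
  closure {x | ∃ f ∈ selectors P F, x = ∫ ω, f ω ∂P}

/-- The expectation of a random set is its Aumann integral. -/
def expectation (P : Measure Ω) (F : Ω → Set E) : Set E := aumannIntegral P F

/-- The map `ω ↦ closed convex hull of F(ω)`. -/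
def coBar (F : Ω → Set E) : Ω → Set E := fun ω => closedConvexHull ℝ (F ω)

/-- `C ∈ ℭ_c(E)` is the sum of the series `∑ C_i`, i.e. the closures of the partial
(Minkowski) sums converge to `C` in the Pompeiu-Hausdorff distance. -/
def IsSetSum (D : ℕ → Set E) (C : Set E) : Prop :=
  C ∈ BddClosedConvexSets E ∧
    Tendsto (fun n => Metric.hausdorffEDist (closure (∑ i ∈ Finset.range n, D i)) C) atTop (𝓝 0)

/-- `C` is the Hukuhara integral of the countably-valued map `G`: it is the sum of the series
`∑ P(T_i) A_i`, for each representation of `G` (and there is one). -/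
def IsCountableHukuharaIntegral (P : Measure Ω) (G : Ω → Set E) (C : Set E) : Prop :=
  IsCountablyValued (BddClosedConvexSets E) G ∧
    ∀ A T, IsRepresentation (BddClosedConvexSets E) G A T →
      IsSetSum (fun i => P.real (T i) • A i) C

/-- `(G_n)` is a sequence in `ℤ¹(Ω, ℭ_c(E))` converging to `F` uniformly a.s. -/
def IsApproximation (P : Measure Ω) (G : ℕ → Ω → Set E) (F : Ω → Set E) : Prop :=
  (∀ n, MemZ1 P (BddClosedConvexSets E) (G n)) ∧
    Tendsto (fun n => essHausdorff P (G n) F) atTop (𝓝 0)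

/-- `C ∈ ℭ_c(E)` is the Hukuhara integral of `F`: approximating sequences exist and, for each
of them, the integrals of its members exist and converge to `C`. -/
def IsHukuharaIntegral (P : Measure Ω) (F : Ω → Set E) (C : Set E) : Prop :=
  C ∈ BddClosedConvexSets E ∧ (∃ G, IsApproximation P G F) ∧
    ∀ G, IsApproximation P G F → ∃ D : ℕ → Set E,
      (∀ n, IsCountableHukuharaIntegral P (G n) (D n)) ∧
      Tendsto (fun n => Metric.hausdorffEDist (D n) C) atTop (𝓝 0)

theorem IsCountableHukuharaIntegral.unique {P : Measure Ω} {G : Ω → Set E} {C C' : Set E}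
    (h : IsCountableHukuharaIntegral P G C) (h' : IsCountableHukuharaIntegral P G C') :
    C = C' := by
  obtain ⟨⟨A, T, hr⟩, hC⟩ := h
  exact limit_unique (hC A T hr).1.1.2.1 (h'.2 A T hr).1.1.2.1 (hC A T hr).2 (h'.2 A T hr).2

/-- The Hukuhara integral is unique. -/
theorem IsHukuharaIntegral.unique {P : Measure Ω} {F : Ω → Set E} {C C' : Set E}
    (h : IsHukuharaIntegral P F C) (h' : IsHukuharaIntegral P F C') : C = C' := by
  obtain ⟨G, hG⟩ := h.2.1
  obtain ⟨D, hD, hl⟩ := h.2.2 G hG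
  obtain ⟨D', hD', hl'⟩ := h'.2.2 G hG
  have : D = D' := funext fun n => (hD n).unique (hD' n)
  subst this
  exact limit_unique h.1.1.2.1 h'.1.1.2.1 hl hl'

open Classical in
/-- The Hukuhara integral of `F` (the empty set if it does not exist). -/
def hukuharaIntegral (P : Measure Ω) (F : Ω → Set E) : Set E :=
  if h : ∃ C, IsHukuharaIntegral P F C then h.choose else ∅

end

end RandomSets

end

/-! ### Countably-valued maps, their selectors, and closed convex hulls -/

namespace RandomSets

section

variable {Ω E : Type*} [MeasurableSpace Ω]

/-! The Aumann integral is the common object: it is shown to satisfy the definition of the Hukuhara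
integral when the values are convex, and to be unchanged by passing from `F` to `coBar F` when `P`
is atomless.

For convex values, the integral of a selector of a countably-valued `G` over a piece `T i` is `P (T
i)` times an average of points of the closed convex set `A i`. So the partial sums of the series
differ from the Aumann integral by at most a tail of `∫ ‖G‖` (`isSetSum_aumannIntegral`). The Aumann
integral is 1-Lipschitz for the essential Hausdorff distance (`hausdorffEDist_aumannIntegral_le`),
so the limit definition applies to every approximating sequence. The Lipschitz bound rests on
near-optimal selectors (`IsStronglyMeasurable.exists_selector`), built from countably-valued
approximations, so `E` need not be separable.

For `MemL1.aumannIntegral_coBar`, Sierpiński's theorem lets a convex combination of points be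
realized as an average over a split piece. Both integrals are closures, so approximate equality is
enough and Lyapunov's theorem is not needed. -/

theorem IsRepresentation.exists_index {K : Set (Set E)} [NormedAddCommGroup E] {G : Ω → Set E}
    {A : ℕ → Set E} {T : ℕ → Set Ω} (h : IsRepresentation K G A T) :
    ∃ k : Ω → ℕ, Measurable k ∧ (∀ ω, G ω = A (k ω)) ∧ ∀ i, T i = k ⁻¹' {i} := by
  have hc : ∀ ω, ∃ i, ω ∈ T i := fun ω => by
    have : ω ∈ ⋃ i, T i := h.cover ▸ Set.mem_univ ω
    simpa using this
  choose k hk using hc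
  have hT : ∀ i, T i = k ⁻¹' {i} := fun i => by
    ext ω
    refine ⟨fun hω => ?_, fun hω => ?_⟩
    · by_contra hne
      exact Set.disjoint_left.1 (h.disjoint (k ω) i hne) (hk ω) hω
    · have : k ω = i := hω
      exact this ▸ hk ω
  exact ⟨k, measurable_to_countable' fun i => hT i ▸ h.measurable i,
    fun ω => h.eq_on _ ω (hk ω), hT⟩

theorem isCountablyValued_comp {K : Set (Set E)} [NormedAddCommGroup E] {A : ℕ → Set E}
    (hA : ∀ i, A i ∈ K) {k : Ω → ℕ} (hk : Measurable k) :
    IsCountablyValued K (fun ω => A (k ω)) := by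
  refine ⟨A, fun i => k ⁻¹' {i}, hA, fun i => hk (measurableSet_singleton i), fun i j hij => ?_,
    ?_, fun i ω hω => ?_⟩
  · exact Disjoint.preimage k (Set.disjoint_singleton.2 hij)
  · ext ω
    simp
  · have : k ω = i := hω
    rw [this]

theorem IsCountablyValued.exists_index {K : Set (Set E)} [NormedAddCommGroup E] {G : Ω → Set E}
    (h : IsCountablyValued K G) :
    ∃ (A : ℕ → Set E) (k : Ω → ℕ), (∀ i, A i ∈ K) ∧ Measurable k ∧ G = fun ω => A (k ω) := by
  obtain ⟨A, T, hr⟩ := h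
  obtain ⟨k, hk, hG, -⟩ := hr.exists_index
  exact ⟨A, k, hr.value_mem, hk, funext hG⟩

theorem stronglyMeasurable_comp_nat [TopologicalSpace E] (x : ℕ → E) {k : Ω → ℕ}
    (hk : Measurable k) : StronglyMeasurable (fun ω => x (k ω)) :=
  (StronglyMeasurable.of_discrete (f := x)).comp_measurable hk

/-- The range is separable; each `ω` takes the first term of a dense sequence closer than `η`. -/
theorem exists_countable_approx [PseudoEMetricSpace E] [Nonempty E] {s : Ω → E} (hs : StronglyMeasurable s)
    {η : ℝ≥0∞} (hη : η ≠ 0) :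
    ∃ (x : ℕ → E) (k : Ω → ℕ), Measurable k ∧ ∀ ω, edist (s ω) (x (k ω)) < η := by
  classical
  rcases isEmpty_or_nonempty Ω with hΩ | ⟨⟨ω₀⟩⟩
  · exact ⟨fun _ => Classical.arbitrary E, fun _ => 0, measurable_const,
      fun ω => (hΩ.false ω).elim⟩
  obtain ⟨c, hc, hsc⟩ := hs.isSeparable_range
  have hne : c.Nonempty := by
    rw [← closure_nonempty_iff]
    exact ⟨_, hsc ⟨ω₀, rfl⟩⟩
  obtain ⟨x, rfl⟩ := hc.exists_eq_range hne
  have hex : ∀ ω, ∃ n, edist (s ω) (x n) < η := fun ω => by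
    obtain ⟨_, ⟨n, rfl⟩, hn⟩ := EMetric.mem_closure_iff.1 (hsc ⟨ω, rfl⟩) η (pos_iff_ne_zero.2 hη)
    exact ⟨n, hn⟩
  refine ⟨x, fun ω => Nat.find (hex ω), measurable_find hex fun n => ?_,
    fun ω => Nat.find_spec (hex ω)⟩
  exact measurableSet_lt (hs.edist stronglyMeasurable_const).measurable measurable_const

variable [NormedAddCommGroup E]

/-- A strongly measurable function is followed by a countably valued selector of a countably valued
map, up to an arbitrarily small loss. -/
theorem exists_countable_selector {s : Ω → E} (hs : StronglyMeasurable s) {A : ℕ → Set E}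
    (hA : ∀ i, (A i).Nonempty) {k : Ω → ℕ} (hk : Measurable k) {η : ℝ≥0∞} (hη : η ≠ 0) :
    ∃ (x : ℕ → E) (κ : Ω → ℕ) (ρ : ℕ → ℕ), Measurable κ ∧ (∀ ω, ρ (κ ω) = k ω) ∧
      (∀ j, x j ∈ A (ρ j)) ∧
      ∀ ω, edist (s ω) (x (κ ω)) ≤ Metric.infEDist (s ω) (A (k ω)) + η := by
  -- One third pays for replacing `s` by `y`, one for replacing it inside `infEDist`, one for the
  -- near-nearest point `z`.
  have h3 : η / 3 ≠ 0 := by simp [ENNReal.div_eq_zero_iff, hη]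
  obtain ⟨y, l, hl, hy⟩ := exists_countable_approx hs h3
  have hex : ∀ p q, ∃ z ∈ A q, edist (y p) z < Metric.infEDist (y p) (A q) + η / 3 :=
    fun p q => Metric.infEDist_lt_iff.1
      (ENNReal.lt_add_right (Metric.infEDist_ne_top (hA q)) h3)
  choose z hzA hz using hex
  -- The new index codes the pair (approximating value, piece); `ρ` recovers the piece.
  refine ⟨fun j => z j.unpair.1 j.unpair.2, fun ω => Nat.pair (l ω) (k ω),
    fun j => j.unpair.2, ?_, fun ω => by simp, fun j => hzA _ _, fun ω => ?_⟩
  · exact (Measurable.of_discrete (f := fun p : ℕ × ℕ => Nat.pair p.1 p.2)).comp (hl.prodMk hk)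
  · simp only [Nat.unpair_pair]
    calc edist (s ω) (z (l ω) (k ω))
        ≤ edist (s ω) (y (l ω)) + edist (y (l ω)) (z (l ω) (k ω)) := edist_triangle _ _ _
      _ ≤ η / 3 + (Metric.infEDist (s ω) (A (k ω)) + η / 3 + η / 3) := by
          gcongr
          · exact (hy ω).le
          · refine (hz _ _).le.trans ?_
            gcongr
            refine (Metric.infEDist_le_infEDist_add_edist (y := s ω)).trans ?_
            gcongr
            rw [edist_comm]
            exact (hy ω).le
      _ = Metric.infEDist (s ω) (A (k ω)) + (η / 3 + η / 3 + η / 3) := by ring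
      _ = _ := by rw [ENNReal.add_thirds]

theorem setNorm_le_iff {A : Set E} {r : ℝ≥0∞} : setNorm A ≤ r ↔ ∀ x ∈ A, ‖x‖ₑ ≤ r := by
  simp [setNorm]

theorem enorm_le_setNorm {A : Set E} {x : E} (hx : x ∈ A) : ‖x‖ₑ ≤ setNorm A :=
  setNorm_le_iff.1 le_rfl x hx

theorem setNorm_le_add_hausdorffEDist (A B : Set E) :
    setNorm A ≤ setNorm B + Metric.hausdorffEDist A B := by
  refine setNorm_le_iff.2 fun x hx => ENNReal.le_of_forall_pos_le_add fun ε hε hlt => ?_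
  have hne : Metric.hausdorffEDist A B ≠ ⊤ := (ENNReal.add_lt_top.1 hlt).2.ne
  obtain ⟨y, hy, hxy⟩ := Metric.exists_edist_lt_of_hausdorffEDist_lt hx
    (ENNReal.lt_add_right hne (ENNReal.coe_ne_zero.2 hε.ne'))
  calc ‖x‖ₑ ≤ ‖y‖ₑ + edist x y := by
        rw [edist_eq_enorm_sub]
        calc ‖x‖ₑ = ‖y + (x - y)‖ₑ := by rw [add_sub_cancel]
          _ ≤ _ := enorm_add_le _ _
    _ ≤ setNorm B + (Metric.hausdorffEDist A B + ε) := add_le_add (enorm_le_setNorm hy) hxy.le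
    _ = _ := by ring

theorem setNorm_lt_top {A : Set E} (hA : Bornology.IsBounded A) : setNorm A < ⊤ := by
  obtain ⟨C, hC⟩ := hA.exists_norm_le
  refine lt_of_le_of_lt (setNorm_le_iff.2 fun x hx => ?_) (ENNReal.ofReal_lt_top (r := C))
  rw [← ofReal_norm]
  exact ENNReal.ofReal_le_ofReal (hC x hx)

theorem isBounded_of_setNorm_lt_top {A : Set E} (hA : setNorm A < ⊤) : Bornology.IsBounded A := by
  refine isBounded_iff_forall_norm_le.2 ⟨(setNorm A).toReal, fun x hx => ?_⟩
  rw [← toReal_enorm]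
  exact ENNReal.toReal_mono hA.ne (enorm_le_setNorm hx)

theorem MemZ1.memL1 {P : Measure Ω} {K : Set (Set E)} {G : Ω → Set E} (hG : MemZ1 P K G) :
    MemL1 P K G where
  value_mem ω := by
    obtain ⟨A, k, hA, -, rfl⟩ := hG.countablyValued.exists_index
    exact hA _
  stronglyMeasurable := by
    refine ⟨fun _ => G, fun _ => hG.countablyValued, ?_⟩
    simp only [essHausdorff, Metric.hausdorffEDist_self]
    exact tendsto_const_nhds.congr fun _ => (essSup_const_bot (μ := P)).symm
  integrable := hG.integrable

theorem lintegral_setNorm_lt_top {P : Measure Ω} [IsFiniteMeasure P] {F G : Ω → Set E}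
    (hF : ∫⁻ ω, setNorm (F ω) ∂P < ∞) (h : essHausdorff P G F < ∞) :
    ∫⁻ ω, setNorm (G ω) ∂P < ∞ := by
  calc ∫⁻ ω, setNorm (G ω) ∂P ≤ ∫⁻ ω, (setNorm (F ω) + essHausdorff P G F) ∂P := by
        refine lintegral_mono_ae ?_
        filter_upwards [ENNReal.ae_le_essSup
          (fun ω => Metric.hausdorffEDist (G ω) (F ω)) (μ := P)] with ω hω
        exact (setNorm_le_add_hausdorffEDist _ _).trans (by gcongr; exact hω)
    _ = ∫⁻ ω, setNorm (F ω) ∂P + essHausdorff P G F * P Set.univ := by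
        -- Splitting off the constant avoids any measurability of `‖F‖`.
        rw [lintegral_add_right _ measurable_const, lintegral_const]
    _ < ∞ := ENNReal.add_lt_top.2 ⟨hF, ENNReal.mul_lt_top h (measure_lt_top _ _)⟩

variable [NormedSpace ℝ E]

theorem setNorm_closedConvexHull (A : Set E) : setNorm (closedConvexHull ℝ A) = setNorm A := by
  refine le_antisymm ?_ (iSup_le_iSup_of_subset subset_closedConvexHull)
  rcases eq_or_ne (setNorm A) ⊤ with h | h
  · simp [h]
  have hsub : closedConvexHull ℝ A ⊆ Metric.closedBall (0 : E) (setNorm A).toReal := by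
    refine closedConvexHull_min (fun x hx => ?_) (convex_closedBall _ _) Metric.isClosed_closedBall
    rw [mem_closedBall_zero_iff, ← toReal_enorm]
    exact ENNReal.toReal_mono h (enorm_le_setNorm hx)
  refine setNorm_le_iff.2 fun x hx => ?_
  have := hsub hx
  rw [mem_closedBall_zero_iff] at this
  rw [← ofReal_norm]
  exact ENNReal.ofReal_le_of_le_toReal this

/-- A closed thickening of a convex set is closed and convex, so it contains the closed hull of `A`
once it contains `A`. The hull of `B` is left unclosed because its points are finite convex
combinations, as needed for the atomless argument. -/
theorem infEDist_le_hausdorffEDist_of_mem_closedConvexHull {A B : Set E} {x : E}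
    (hx : x ∈ closedConvexHull ℝ A) :
    Metric.infEDist x (convexHull ℝ B) ≤ Metric.hausdorffEDist A B := by
  rcases eq_or_ne (Metric.hausdorffEDist A B) ⊤ with h | h
  · simp [h]
  have hsub : closedConvexHull ℝ A ⊆
      Metric.cthickening (Metric.hausdorffEDist A B).toReal (convexHull ℝ B) := by
    refine closedConvexHull_min (fun y hy => ?_) ((convex_convexHull ℝ B).cthickening _)
      Metric.isClosed_cthickening
    rw [Metric.mem_cthickening_iff, ENNReal.ofReal_toReal h]
    exact (Metric.infEDist_anti (subset_convexHull ℝ B)).trans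
      (Metric.infEDist_le_hausdorffEDist_of_mem hy)
  have := hsub hx
  rwa [Metric.mem_cthickening_iff, ENNReal.ofReal_toReal h] at this

theorem hausdorffEDist_closedConvexHull_le (A B : Set E) :
    Metric.hausdorffEDist (closedConvexHull ℝ A) (closedConvexHull ℝ B) ≤
      Metric.hausdorffEDist A B := by
  refine Metric.hausdorffEDist_le_of_infEDist (fun x hx => ?_) fun x hx => ?_
  · exact (Metric.infEDist_anti convexHull_subset_closedConvexHull).trans
      (infEDist_le_hausdorffEDist_of_mem_closedConvexHull hx)
  · rw [Metric.hausdorffEDist_comm]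
    exact (Metric.infEDist_anti convexHull_subset_closedConvexHull).trans
      (infEDist_le_hausdorffEDist_of_mem_closedConvexHull hx)

theorem closedConvexHull_mem {A : Set E} (hA : A ∈ BddClosedSets E) :
    (closedConvexHull ℝ A : Set E) ∈ BddClosedConvexSets E := by
  refine ⟨⟨hA.1.mono subset_closedConvexHull, isClosed_closedConvexHull, ?_⟩,
    convex_closedConvexHull⟩
  apply isBounded_of_setNorm_lt_top
  rw [setNorm_closedConvexHull]
  exact setNorm_lt_top hA.2.2

theorem IsCountablyValued.coBar {G : Ω → Set E} (hG : IsCountablyValued (BddClosedSets E) G) :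
    IsCountablyValued (BddClosedConvexSets E) (coBar G) := by
  obtain ⟨A, k, hA, hk, rfl⟩ := hG.exists_index
  exact isCountablyValued_comp (fun i => closedConvexHull_mem (hA i)) hk

theorem essHausdorff_coBar_le (P : Measure Ω) (G F : Ω → Set E) :
    essHausdorff P (coBar G) (coBar F) ≤ essHausdorff P G F :=
  essSup_mono_ae (Eventually.of_forall fun _ => hausdorffEDist_closedConvexHull_le _ _)

theorem MemL1.coBar {P : Measure Ω} {F : Ω → Set E} (hF : MemL1 P (BddClosedSets E) F) :
    MemL1 P (BddClosedConvexSets E) (coBar F) where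
  value_mem ω := closedConvexHull_mem (hF.value_mem ω)
  stronglyMeasurable := by
    obtain ⟨G, hG, hlim⟩ := hF.stronglyMeasurable
    exact ⟨fun n => RandomSets.coBar (G n), fun n => (hG n).coBar,
      tendsto_of_tendsto_of_tendsto_of_le_of_le tendsto_const_nhds hlim (fun _ => bot_le)
        fun n => essHausdorff_coBar_le P _ _⟩
  integrable := by
    simpa only [RandomSets.coBar, setNorm_closedConvexHull] using hF.integrable

theorem MemL1.toBddClosed {P : Measure Ω} {F : Ω → Set E}
    (hF : MemL1 P (BddClosedConvexSets E) F) : MemL1 P (BddClosedSets E) F where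
  value_mem ω := (hF.value_mem ω).1
  stronglyMeasurable := by
    obtain ⟨G, hG, hlim⟩ := hF.stronglyMeasurable
    refine ⟨G, fun n => ?_, hlim⟩
    obtain ⟨A, T, h⟩ := hG n
    exact ⟨A, T, fun i => (h.value_mem i).1, h.measurable, h.disjoint, h.cover, h.eq_on⟩
  integrable := hF.integrable

theorem MemL1.exists_approximation {P : Measure Ω} [IsFiniteMeasure P] {F : Ω → Set E}
    (hF : MemL1 P (BddClosedConvexSets E) F) : ∃ G, IsApproximation P G F := by
  obtain ⟨G, hG, hlim⟩ := hF.stronglyMeasurable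
  -- Early terms may fail to be integrable; those at finite distance from `F` are integrable.
  obtain ⟨N, hN⟩ := eventually_atTop.1 (hlim.eventually_lt_const ENNReal.zero_lt_top)
  exact ⟨fun n => G (n + N), fun n => ⟨hG _, lintegral_setNorm_lt_top hF.integrable
    (hN _ (Nat.le_add_left _ _))⟩, (tendsto_add_atTop_iff_nat N).2 hlim⟩

end

end RandomSets

/-! ### Near-optimal selectors and the Lipschitz bound for the Aumann integral -/

namespace RandomSets

section

variable {Ω E : Type*} [MeasurableSpace Ω] [NormedAddCommGroup E]

theorem ae_hausdorffEDist_le (P : Measure Ω) (G F : Ω → Set E) :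
    ∀ᵐ ω ∂P, Metric.hausdorffEDist (G ω) (F ω) ≤ essHausdorff P G F :=
  ENNReal.ae_le_essSup _

/-- A strongly measurable set-valued map has selectors which realize, up to an arbitrarily small
loss, the distance to a given strongly measurable function. -/
theorem IsStronglyMeasurable.exists_selector [CompleteSpace E] {P : Measure Ω} {F : Ω → Set E}
    (hF : IsStronglyMeasurable P (BddClosedSets E) F) (hFv : ∀ ω, F ω ∈ BddClosedSets E)
    {g : Ω → E} (hg : StronglyMeasurable g) {η : ℝ≥0∞} (h0 : η ≠ 0) (ht : η ≠ ∞) :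
    ∃ f : Ω → E, AEStronglyMeasurable f P ∧ (∀ ω, f ω ∈ F ω) ∧
      ∀ᵐ ω ∂P, edist (g ω) (f ω) ≤ Metric.infEDist (g ω) (F ω) + η := by
  classical
  obtain ⟨G, hG, hlim⟩ := hF
  -- The loss is `2c` in the first step and at most `4c` in the geometric series that follows.
  set c : ℝ≥0∞ := η / 6 with hc
  have hc0 : c ≠ 0 := by simp [hc, ENNReal.div_eq_zero_iff, h0]
  have hct : c ≠ ∞ := ENNReal.div_ne_top ht (by norm_num)
  have hcn : ∀ n : ℕ, c / 2 ^ n ≠ 0 := fun n => by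
    simp [ENNReal.div_eq_zero_iff, hc0, ENNReal.pow_eq_top_iff]
  have hφ : ∀ n : ℕ, ∃ m, essHausdorff P (G m) F ≤ c / 2 ^ n := fun n =>
    (hlim.eventually_le_const (pos_iff_ne_zero.2 (hcn n))).exists
  choose φ hφ using hφ
  have hstep : ∀ (n : ℕ) (s : {s : Ω → E // StronglyMeasurable s}),
      ∃ s' : {s : Ω → E // StronglyMeasurable s}, ∀ ω, s'.1 ω ∈ G (φ n) ω ∧
        edist (s.1 ω) (s'.1 ω) ≤ Metric.infEDist (s.1 ω) (G (φ n) ω) + c / 2 ^ n := fun n s => by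
    obtain ⟨A, k, hA, hk, hGA⟩ := (hG (φ n)).exists_index
    obtain ⟨x, κ, ρ, hκ, hρ, hx, hd⟩ :=
      exists_countable_selector s.2 (fun i => (hA i).1) hk (hcn n)
    refine ⟨⟨_, stronglyMeasurable_comp_nat x hκ⟩, fun ω => ?_⟩
    rw [hGA]
    refine ⟨?_, hd ω⟩
    have := hx (κ ω)
    rwa [hρ] at this
  choose step hstep using hstep
  -- Start at `g`; each term is an almost nearest selector of the next approximation `G (φ n)`.
  -- Estimates between successive terms start at `u 1`, since `g` may be far from `F`.
  let u : ℕ → {s : Ω → E // StronglyMeasurable s} := fun n => Nat.rec ⟨g, hg⟩ step n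
  have hmem : ∀ n ω, (u (n + 1)).1 ω ∈ G (φ n) ω := fun n ω => (hstep n (u n) ω).1
  have hdist : ∀ n ω, edist ((u n).1 ω) ((u (n + 1)).1 ω) ≤
      Metric.infEDist ((u n).1 ω) (G (φ n) ω) + c / 2 ^ n := fun n ω => (hstep n (u n) ω).2
  have hae : ∀ᵐ ω ∂P, ∀ n, Metric.hausdorffEDist (G (φ n) ω) (F ω) ≤ c / 2 ^ n :=
    ae_all_iff.2 fun n => (ae_hausdorffEDist_le P (G (φ n)) F).mono fun ω hω => hω.trans (hφ n)
  have hsucc : ∀ n : ℕ, c / 2 ^ (n + 1) + c / 2 ^ (n + 1) = c / 2 ^ n := fun n => by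
    have h : c / 2 ^ (n + 1) = c / 2 ^ n / 2 := by
      rw [div_eq_mul_inv, div_eq_mul_inv, div_eq_mul_inv, pow_succ,
        ENNReal.mul_inv (by simp) (by simp), mul_assoc]
    rw [h, ENNReal.add_halves]
  have key : ∀ᵐ ω ∂P, ∃ y ∈ F ω, Tendsto (fun n => (u (n + 1)).1 ω) atTop (𝓝 y) ∧
      edist (g ω) y ≤ Metric.infEDist (g ω) (F ω) + η := by
    filter_upwards [hae] with ω hω
    have hgeo : ∀ n, edist ((u (n + 1)).1 ω) ((u (n + 1 + 1)).1 ω) ≤ (2 * c) / 2 ^ n := fun n => by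
      have h1 : Metric.infEDist ((u (n + 1)).1 ω) (F ω) ≤ c / 2 ^ n :=
        (Metric.infEDist_le_hausdorffEDist_of_mem (hmem n ω)).trans (hω n)
      have h2 : Metric.infEDist ((u (n + 1)).1 ω) (G (φ (n + 1)) ω) ≤
          c / 2 ^ n + c / 2 ^ (n + 1) := by
        refine (Metric.infEDist_le_infEDist_add_hausdorffEDist (s := F ω)).trans ?_
        rw [Metric.hausdorffEDist_comm]
        exact add_le_add h1 (hω _)
      calc _ ≤ c / 2 ^ n + c / 2 ^ (n + 1) + c / 2 ^ (n + 1) :=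
            (hdist (n + 1) ω).trans (by gcongr)
        _ = c / 2 ^ n + c / 2 ^ n := by rw [add_assoc, hsucc]
        _ = _ := by rw [two_mul, ENNReal.add_div]
    have hcauchy : CauchySeq fun n => (u (n + 1)).1 ω :=
      cauchySeq_of_edist_le_geometric_two (2 * c) (ENNReal.mul_ne_top (by simp) hct) hgeo
    obtain ⟨y, hy⟩ := cauchySeq_tendsto_of_complete hcauchy
    refine ⟨y, ?_, hy, ?_⟩
    · rw [Metric.mem_iff_infEDist_zero_of_closed (hFv ω).2.1]
      refine le_antisymm ?_ bot_le
      have hl : Tendsto (fun n => Metric.infEDist ((u (n + 1)).1 ω) (F ω)) atTop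
          (𝓝 (Metric.infEDist y (F ω))) := (Metric.continuous_infEDist.tendsto y).comp hy
      have hz : Tendsto (fun n : ℕ => c / 2 ^ n) atTop (𝓝 0) := by
        have := ENNReal.Tendsto.const_mul (a := c)
          (ENNReal.tendsto_pow_atTop_nhds_zero_of_lt_one (r := 2⁻¹) (by norm_num)) (Or.inr hct)
        simpa [div_eq_mul_inv, ENNReal.inv_pow] using this
      exact le_of_tendsto_of_tendsto' hl hz fun n =>
        (Metric.infEDist_le_hausdorffEDist_of_mem (hmem n ω)).trans (hω n)
    · have h1 : edist ((u 1).1 ω) y ≤ 2 * (2 * c) :=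
        edist_le_of_edist_le_geometric_two_of_tendsto₀ (2 * c) hgeo hy
      have h2 : edist (g ω) ((u 1).1 ω) ≤ Metric.infEDist (g ω) (F ω) + c + c := by
        refine (hdist 0 ω).trans ?_
        rw [pow_zero, div_one]
        gcongr
        refine (Metric.infEDist_le_infEDist_add_hausdorffEDist (s := F ω)).trans ?_
        rw [Metric.hausdorffEDist_comm]
        have := hω 0
        rw [pow_zero, div_one] at this
        exact add_le_add le_rfl this
      have h6 : c * 6 = η := ENNReal.div_mul_cancel (by norm_num) (by norm_num)
      calc edist (g ω) y ≤ edist (g ω) ((u 1).1 ω) + edist ((u 1).1 ω) y := edist_triangle _ _ _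
        _ ≤ (Metric.infEDist (g ω) (F ω) + c + c) + 2 * (2 * c) := add_le_add h2 h1
        _ = Metric.infEDist (g ω) (F ω) + c * 6 := by ring
        _ = _ := by rw [h6]
  -- On the exceptional null set any point of `F ω` serves, so membership holds everywhere.
  let f : Ω → E := fun ω =>
    if h : ∃ y ∈ F ω, Tendsto (fun n => (u (n + 1)).1 ω) atTop (𝓝 y) ∧
      edist (g ω) y ≤ Metric.infEDist (g ω) (F ω) + η then h.choose else (hFv ω).1.some
  have hf : ∀ᵐ ω ∂P, Tendsto (fun n => (u (n + 1)).1 ω) atTop (𝓝 (f ω)) ∧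
      edist (g ω) (f ω) ≤ Metric.infEDist (g ω) (F ω) + η := by
    filter_upwards [key] with ω hω
    simp only [f, dif_pos hω]
    exact hω.choose_spec.2
  refine ⟨f, ?_, fun ω => ?_, hf.mono fun ω h => h.2⟩
  · exact aestronglyMeasurable_of_tendsto_ae atTop
      (fun n => (u (n + 1)).2.aestronglyMeasurable) (hf.mono fun ω h => h.1)
  · simp only [f]
    split_ifs with h
    · exact h.choose_spec.1
    · exact (hFv ω).1.some_mem

theorem integrable_of_mem {P : Measure Ω} {F : Ω → Set E} (hF : ∫⁻ ω, setNorm (F ω) ∂P < ∞)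
    {f : Ω → E} (hf : AEStronglyMeasurable f P) (hmem : ∀ ω, f ω ∈ F ω) : Integrable f P :=
  ⟨hf, (lintegral_mono fun ω => enorm_le_setNorm (hmem ω)).trans_lt hF⟩

variable [NormedSpace ℝ E]

theorem edist_integral_le_of_ae_edist_le {P : Measure Ω} [IsProbabilityMeasure P] {f g : Ω → E}
    (hf : Integrable f P) (hg : Integrable g P) {r : ℝ≥0∞}
    (h : ∀ᵐ ω ∂P, edist (f ω) (g ω) ≤ r) : edist (∫ ω, f ω ∂P) (∫ ω, g ω ∂P) ≤ r :=
  calc edist (∫ ω, f ω ∂P) (∫ ω, g ω ∂P) ≤ ∫⁻ ω, edist (f ω) (g ω) ∂P :=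
        edist_integral_le_lintegral_edist hf hg
    _ ≤ ∫⁻ _, r ∂P := lintegral_mono_ae h
    _ = r := by simp

theorem MemL1.exists_selector_integral [CompleteSpace E] {P : Measure Ω} [IsProbabilityMeasure P]
    {F : Ω → Set E} (hF : MemL1 P (BddClosedSets E) F) {g : Ω → E} (hg : Integrable g P)
    {r η : ℝ≥0∞} (hr : ∀ᵐ ω ∂P, Metric.infEDist (g ω) (F ω) ≤ r) (h0 : η ≠ 0) (ht : η ≠ ∞) :
    ∃ f ∈ selectors P F, edist (∫ ω, g ω ∂P) (∫ ω, f ω ∂P) ≤ r + η := by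
  obtain ⟨f, hfm, hfF, hd⟩ := hF.stronglyMeasurable.exists_selector hF.value_mem
    hg.1.stronglyMeasurable_mk h0 ht
  have hf : Integrable f P := integrable_of_mem hF.integrable hfm hfF
  refine ⟨f, ⟨hf, hfF⟩, edist_integral_le_of_ae_edist_le hg hf ?_⟩
  filter_upwards [hd, hr, hg.1.ae_eq_mk] with ω h1 h2 h3
  rw [← h3] at h1
  exact h1.trans (by gcongr)

theorem MemL1.aumannIntegral_nonempty [CompleteSpace E] {P : Measure Ω} [IsProbabilityMeasure P]
    {F : Ω → Set E} (hF : MemL1 P (BddClosedSets E) F) : (aumannIntegral P F).Nonempty := by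
  obtain ⟨f, hfm, hfF, -⟩ := hF.stronglyMeasurable.exists_selector hF.value_mem
    (stronglyMeasurable_const (b := (0 : E))) one_ne_zero ENNReal.one_ne_top
  exact ⟨_, subset_closure ⟨f, ⟨integrable_of_mem hF.integrable hfm hfF, hfF⟩, rfl⟩⟩

theorem isBounded_aumannIntegral {P : Measure Ω} {F : Ω → Set E}
    (hF : ∫⁻ ω, setNorm (F ω) ∂P < ∞) : Bornology.IsBounded (aumannIntegral P F) := by
  refine Bornology.IsBounded.closure (isBounded_of_setNorm_lt_top (lt_of_le_of_lt ?_ hF))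
  refine setNorm_le_iff.2 ?_
  rintro _ ⟨f, hf, rfl⟩
  exact (enorm_integral_le_lintegral_enorm f).trans
    (lintegral_mono fun ω => enorm_le_setNorm (hf.2 ω))

theorem convex_aumannIntegral {P : Measure Ω} {F : Ω → Set E} (hF : ∀ ω, Convex ℝ (F ω)) :
    Convex ℝ (aumannIntegral P F) := by
  refine Convex.closure ?_
  rintro _ ⟨f, hf, rfl⟩ _ ⟨g, hg, rfl⟩ a b ha hb hab
  refine ⟨fun ω => a • f ω + b • g ω, ⟨(hf.1.smul a).add (hg.1.smul b),
    fun ω => hF ω (hf.2 ω) (hg.2 ω) ha hb hab⟩, ?_⟩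
  have h : ∫ ω, (a • f ω + b • g ω) ∂P = ∫ ω, a • f ω ∂P + ∫ ω, b • g ω ∂P :=
    integral_add (hf.1.smul a) (hg.1.smul b)
  rw [h, integral_smul, integral_smul]

theorem MemL1.aumannIntegral_mem [CompleteSpace E] {P : Measure Ω} [IsProbabilityMeasure P]
    {F : Ω → Set E} (hF : MemL1 P (BddClosedConvexSets E) F) :
    aumannIntegral P F ∈ BddClosedConvexSets E :=
  ⟨⟨hF.toBddClosed.aumannIntegral_nonempty, isClosed_closure,
    isBounded_aumannIntegral hF.integrable⟩, convex_aumannIntegral fun ω => (hF.value_mem ω).2⟩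

/-- Each selector of one map is followed by a selector of the other within the essential distance
plus `η`, and integration against a probability measure does not increase this bound. -/
theorem hausdorffEDist_aumannIntegral_le [CompleteSpace E] {P : Measure Ω}
    [IsProbabilityMeasure P] {F G : Ω → Set E} (hF : MemL1 P (BddClosedSets E) F)
    (hG : MemL1 P (BddClosedSets E) G) :
    Metric.hausdorffEDist (aumannIntegral P G) (aumannIntegral P F) ≤ essHausdorff P G F := by
  unfold aumannIntegral
  rw [Metric.hausdorffEDist_closure]
  refine ENNReal.le_of_forall_pos_le_add fun η hη _ => ?_
  have h0 : (η : ℝ≥0∞) ≠ 0 := ENNReal.coe_ne_zero.2 hη.ne'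
  refine Metric.hausdorffEDist_le_of_mem_edist ?_ ?_
  · rintro _ ⟨g, hg, rfl⟩
    obtain ⟨f, hf, hd⟩ := hF.exists_selector_integral hg.1 ((ae_hausdorffEDist_le P G F).mono
      fun ω hω => (Metric.infEDist_le_hausdorffEDist_of_mem (hg.2 ω)).trans hω) h0
      ENNReal.coe_ne_top
    exact ⟨_, ⟨f, hf, rfl⟩, hd⟩
  · rintro _ ⟨f, hf, rfl⟩
    obtain ⟨g, hg, hd⟩ := hG.exists_selector_integral hf.1 ((ae_hausdorffEDist_le P G F).mono
      fun ω hω => (Metric.infEDist_le_hausdorffEDist_of_mem (hf.2 ω)).trans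
        (Metric.hausdorffEDist_comm.trans_le hω)) h0 ENNReal.coe_ne_top
    exact ⟨_, ⟨g, hg, rfl⟩, hd⟩

end

end RandomSets

/-! ### Convex values: the Aumann integral is the Hukuhara integral -/

namespace RandomSets

section

variable {Ω E : Type*} [MeasurableSpace Ω] [NormedAddCommGroup E] [NormedSpace ℝ E]

theorem integral_eq_sum_add_tail {P : Measure Ω} {f : Ω → E} (hf : Integrable f P) {k : Ω → ℕ}
    (hk : Measurable k) (n : ℕ) :
    ∫ ω, f ω ∂P = ∑ i ∈ Finset.range n, ∫ ω in k ⁻¹' {i}, f ω ∂P + ∫ ω in k ⁻¹' Set.Ici n, f ω ∂P := by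
  have hU : ⋃ i ∈ Finset.range n, k ⁻¹' {i} = (k ⁻¹' Set.Ici n)ᶜ := by
    ext ω
    simp
  rw [← integral_biUnion_finset (Finset.range n) (fun i _ => hk (measurableSet_singleton i))
    (fun i _ j _ hij => Disjoint.preimage k (Set.disjoint_singleton.2 hij))
    (fun i _ => hf.integrableOn), hU, add_comm]
  exact (integral_add_compl (hk measurableSet_Ici) hf).symm

theorem edist_integral_sum_le {P : Measure Ω} {f : Ω → E} (hf : Integrable f P) {G : Ω → Set E}
    (hmem : ∀ ω, f ω ∈ G ω) {k : Ω → ℕ} (hk : Measurable k) (n : ℕ) :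
    edist (∫ ω, f ω ∂P) (∑ i ∈ Finset.range n, ∫ ω in k ⁻¹' {i}, f ω ∂P) ≤
      ∫⁻ ω in k ⁻¹' Set.Ici n, setNorm (G ω) ∂P := by
  rw [integral_eq_sum_add_tail hf hk n, edist_eq_enorm_sub, add_sub_cancel_left]
  exact (enorm_integral_le_lintegral_enorm _).trans
    (lintegral_mono fun ω => enorm_le_setNorm (hmem ω))

theorem tendsto_lintegral_tail {P : Measure Ω} [IsFiniteMeasure P] {φ : Ω → ℝ≥0∞}
    (hφ : ∫⁻ ω, φ ω ∂P ≠ ∞) {k : Ω → ℕ} (hk : Measurable k) :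
    Tendsto (fun n => ∫⁻ ω in k ⁻¹' Set.Ici n, φ ω ∂P) atTop (𝓝 0) := by
  refine tendsto_setLIntegral_zero hφ ?_
  have hI : ⋂ n, k ⁻¹' Set.Ici n = ∅ := by
    ext ω
    simpa using ⟨k ω + 1, Nat.lt_succ_self _⟩
  rw [← measure_empty (μ := P), ← hI]
  exact tendsto_measure_iInter_atTop (fun n => (hk measurableSet_Ici).nullMeasurableSet)
    (fun m n hmn => Set.preimage_mono (Set.Ici_subset_Ici.2 hmn)) ⟨0, measure_ne_top _ _⟩

theorem setIntegral_mem_smul [CompleteSpace E] {P : Measure Ω} [IsFiniteMeasure P] {A : Set E}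
    (hA : A ∈ BddClosedConvexSets E) {T : Set Ω} (hT : MeasurableSet T) {f : Ω → E}
    (hf : Integrable f P) (hmem : ∀ ω ∈ T, f ω ∈ A) : ∫ ω in T, f ω ∂P ∈ P.real T • A := by
  rcases eq_or_ne (P T) 0 with h | h
  · rw [setIntegral_measure_zero _ h, measureReal_def, h, ENNReal.toReal_zero,
      Set.zero_smul_set hA.1.1]
    rfl
  · have hav := hA.2.set_average_mem hA.1.2.1 h (measure_ne_top P T)
      (ae_restrict_of_forall_mem hT hmem) hf.integrableOn
    rw [setAverage_eq] at hav
    refine ⟨_, hav, ?_⟩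
    have h0 : P.real T ≠ 0 := (measureReal_ne_zero_iff (measure_ne_top P T)).2 h
    simp only [smul_smul, mul_inv_cancel₀ h0, one_smul]

/-- A selector's integral is matched with the sum of its integrals over the first `n` pieces.
Conversely, a point of the partial sum comes from a selector constant on each piece. Both errors are
bounded by the integral of `‖G‖` over the remaining pieces. -/
theorem isSetSum_aumannIntegral [CompleteSpace E] {P : Measure Ω} [IsProbabilityMeasure P]
    {G : Ω → Set E} (hG : MemZ1 P (BddClosedConvexSets E) G) {A : ℕ → Set E} {T : ℕ → Set Ω}
    (h : IsRepresentation (BddClosedConvexSets E) G A T) :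
    IsSetSum (fun i => P.real (T i) • A i) (aumannIntegral P G) := by
  refine ⟨hG.memL1.aumannIntegral_mem, ?_⟩
  obtain ⟨k, hk, hGk, hT⟩ := h.exists_index
  have hTm : ∀ i, MeasurableSet (k ⁻¹' {i}) := fun i => hk (measurableSet_singleton i)
  have htail := tendsto_lintegral_tail hG.integrable.ne hk
  refine tendsto_of_tendsto_of_tendsto_of_le_of_le tendsto_const_nhds htail (fun _ => bot_le)
    fun n => ?_
  simp only [aumannIntegral, hT]
  rw [Metric.hausdorffEDist_closure]
  refine Metric.hausdorffEDist_le_of_mem_edist ?_ ?_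
  · intro x hx
    rw [Set.mem_finsetSum] at hx
    obtain ⟨y, hy, rfl⟩ := hx
    have hex : ∀ i, ∃ a ∈ A i, i ∈ Finset.range n → P.real (k ⁻¹' {i}) • a = y i := fun i => by
      by_cases hi : i ∈ Finset.range n
      · obtain ⟨a, ha, hay⟩ := hy hi
        exact ⟨a, ha, fun _ => hay⟩
      · exact ⟨_, (h.value_mem i).1.1.some_mem, fun hi' => (hi hi').elim⟩
    choose a haA hay using hex
    have hmem : ∀ ω, a (k ω) ∈ G ω := fun ω => hGk ω ▸ haA _
    have hint : Integrable (fun ω => a (k ω)) P := integrable_of_mem hG.integrable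
      (stronglyMeasurable_comp_nat a hk).aestronglyMeasurable hmem
    refine ⟨_, ⟨fun ω => a (k ω), ⟨hint, hmem⟩, rfl⟩, ?_⟩
    have hsum : ∑ i ∈ Finset.range n, y i =
        ∑ i ∈ Finset.range n, ∫ ω in k ⁻¹' {i}, a (k ω) ∂P := by
      refine Finset.sum_congr rfl fun i hi => ?_
      rw [setIntegral_congr_fun (g := fun _ => a i) (hTm i) fun ω (hω : k ω = i) => by
        simp only [hω], setIntegral_const, hay i hi]
    rw [hsum, edist_comm]
    exact edist_integral_sum_le hint hmem hk n
  · rintro _ ⟨f, hf, rfl⟩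
    refine ⟨_, ?_, edist_integral_sum_le hf.1 hf.2 hk n⟩
    refine Set.finsetSum_mem_finsetSum _ _ _ fun i _ => ?_
    exact setIntegral_mem_smul (h.value_mem i) (hTm i) hf.1 fun ω (hω : k ω = i) => by
      have := hf.2 ω
      rwa [hGk, hω] at this

theorem isHukuharaIntegral_aumannIntegral [CompleteSpace E] {P : Measure Ω}
    [IsProbabilityMeasure P] {F : Ω → Set E} (hF : MemL1 P (BddClosedConvexSets E) F) :
    IsHukuharaIntegral P F (aumannIntegral P F) := by
  refine ⟨hF.aumannIntegral_mem, hF.exists_approximation, fun G hG =>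
    ⟨fun n => aumannIntegral P (G n), fun n => ⟨(hG.1 n).countablyValued,
      fun A T h => isSetSum_aumannIntegral (hG.1 n) h⟩, ?_⟩⟩
  exact tendsto_of_tendsto_of_tendsto_of_le_of_le tendsto_const_nhds hG.2 (fun _ => bot_le)
    fun n => hausdorffEDist_aumannIntegral_le hF.toBddClosed (hG.1 n).memL1.toBddClosed

theorem IsHukuharaIntegral.hukuharaIntegral_eq {P : Measure Ω} {F : Ω → Set E} {C : Set E}
    (h : IsHukuharaIntegral P F C) : hukuharaIntegral P F = C := by
  have hex : ∃ C, IsHukuharaIntegral P F C := ⟨C, h⟩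
  rw [hukuharaIntegral, dif_pos hex]
  exact hex.choose_spec.unique h

end

end RandomSets

/-! ### Atomless measures: Sierpiński's theorem and convexification -/

namespace RandomSets

section

variable {Ω E : Type*} [MeasurableSpace Ω]

theorem Atomless.exists_measureReal_le_half {P : Measure Ω} [IsFiniteMeasure P] (hP : Atomless P)
    {S : Set Ω} (hS : MeasurableSet S) (h0 : 0 < P.real S) :
    ∃ T ⊆ S, MeasurableSet T ∧ 0 < P.real T ∧ P.real T ≤ P.real S / 2 := by
  obtain ⟨T, hTS, hT, hT0, hlt⟩ := hP S hS (ENNReal.toReal_pos_iff.1 h0).1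
  have hlt' : P.real T < P.real S := (ENNReal.toReal_lt_toReal (by simp) (by simp)).2 hlt
  have hT0' : 0 < P.real T := ENNReal.toReal_pos hT0.ne' (by simp)
  rcases le_total (P.real T) (P.real S / 2) with h | h
  · exact ⟨T, hTS, hT, hT0', h⟩
  · have hd : P.real (S \ T) = P.real S - P.real T := measureReal_sdiff hTS hT
    exact ⟨S \ T, Set.sdiff_subset, hS.diff hT, by linarith, by linarith⟩

theorem Atomless.exists_measureReal_le {P : Measure Ω} [IsFiniteMeasure P] (hP : Atomless P)
    {S : Set Ω} (hS : MeasurableSet S) (h0 : 0 < P.real S) {ε : ℝ} (hε : 0 < ε) :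
    ∃ T ⊆ S, MeasurableSet T ∧ 0 < P.real T ∧ P.real T ≤ ε := by
  have h : ∀ n : ℕ, ∃ T ⊆ S, MeasurableSet T ∧ 0 < P.real T ∧ P.real T ≤ P.real S / 2 ^ n := by
    intro n
    induction n with
    | zero => exact ⟨S, subset_rfl, hS, h0, by simp⟩
    | succ n ih =>
      obtain ⟨T, hTS, hT, hT0, hle⟩ := ih
      obtain ⟨T', hT'T, hT', hT'0, hle'⟩ := hP.exists_measureReal_le_half hT hT0
      refine ⟨T', hT'T.trans hTS, hT', hT'0, hle'.trans ?_⟩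
      rw [pow_succ, ← div_div]
      gcongr
  have hlim : Tendsto (fun n : ℕ => P.real S / 2 ^ n) atTop (𝓝 0) :=
    tendsto_const_nhds.div_atTop (tendsto_pow_atTop_atTop_of_one_lt one_lt_two)
  obtain ⟨n, hn⟩ := (hlim.eventually_le_const hε).exists
  obtain ⟨T, hTS, hT, hT0, hle⟩ := h n
  exact ⟨T, hTS, hT, hT0, hle.trans hn⟩

/-- **Sierpiński's theorem**: a finite atomless measure takes all intermediate values. -/
theorem Atomless.exists_measureReal_eq {P : Measure Ω} [IsFiniteMeasure P] (hP : Atomless P)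
    {S : Set Ω} (hS : MeasurableSet S) {c : ℝ} (hc0 : 0 ≤ c) (hc : c ≤ P.real S) :
    ∃ T ⊆ S, MeasurableSet T ∧ P.real T = c := by
  let K : Set (Set Ω) := {B | B ⊆ S ∧ MeasurableSet B ∧ P.real B ≤ c}
  -- Greedy choice: go at least halfway to the supremum of measures available to admissible
  -- supersets of `B`.
  have hstep : ∀ B : K, ∃ B' : K, B.1 ⊆ B'.1 ∧
      ∀ C ∈ K, B.1 ⊆ C → (P.real B.1 + P.real C) / 2 ≤ P.real B'.1 := by
    intro B
    let V : Set ℝ := (fun C => P.real C) '' {C | C ∈ K ∧ B.1 ⊆ C}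
    have hV : BddAbove V := ⟨c, by
      rintro _ ⟨C, hC, rfl⟩
      exact hC.1.2.2⟩
    have hle : ∀ C ∈ K, B.1 ⊆ C → P.real C ≤ sSup V := fun C hC hBC =>
      le_csSup hV ⟨C, ⟨hC, hBC⟩, rfl⟩
    rcases (hle B.1 B.2 subset_rfl).eq_or_lt with h | h
    · refine ⟨B, subset_rfl, fun C hC hBC => ?_⟩
      have := hle C hC hBC
      linarith
    · obtain ⟨_, ⟨B', hB', rfl⟩, hlt⟩ := exists_lt_of_lt_csSup
        (⟨_, B.1, ⟨B.2, subset_rfl⟩, rfl⟩ : V.Nonempty)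
        (show (P.real B.1 + sSup V) / 2 < sSup V by linarith)
      refine ⟨⟨B', hB'.1⟩, hB'.2, fun C hC hBC => ?_⟩
      have := hle C hC hBC
      simp only at hlt ⊢
      linarith
  choose next hsub hnext using hstep
  let B : ℕ → K := fun n => Nat.rec ⟨∅, Set.empty_subset _, MeasurableSet.empty, by simpa⟩
    (fun _ B => next B) n
  have hmono : Monotone fun n => (B n).1 := monotone_nat_of_le_succ fun n => hsub (B n)
  let T := ⋃ n, (B n).1
  have hTS : T ⊆ S := Set.iUnion_subset fun n => (B n).2.1
  have hTm : MeasurableSet T := MeasurableSet.iUnion fun n => (B n).2.2.1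
  have hlim : Tendsto (fun n => P.real (B n).1) atTop (𝓝 (P.real T)) :=
    (ENNReal.tendsto_toReal (measure_ne_top P T)).comp (tendsto_measure_iUnion_atTop hmono)
  have hTc : P.real T ≤ c := le_of_tendsto' hlim fun n => (B n).2.2.2
  refine ⟨T, hTS, hTm, hTc.antisymm (le_of_not_gt fun hlt => ?_)⟩
  have hd : P.real (S \ T) = P.real S - P.real T := measureReal_sdiff hTS hTm
  obtain ⟨R, hRS, hR, hR0, hRle⟩ := hP.exists_measureReal_le (hS.diff hTm)
    (by linarith) (sub_pos.2 hlt)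
  have hU : P.real (T ∪ R) = P.real T + P.real R :=
    measureReal_union (Set.disjoint_left.2 fun ω hω hω' => (hRS hω').2 hω) hR
  have hK : T ∪ R ∈ K :=
    ⟨Set.union_subset hTS (hRS.trans Set.sdiff_subset), hTm.union hR, by linarith⟩
  -- If `P T < c`, then `T ∪ R` is an admissible superset of every `B n`; in the limit the halfway
  -- rule forces `P (T ∪ R) ≤ P T`, though `R` has positive measure.
  have hge : ∀ n, (P.real (B n).1 + P.real (T ∪ R)) / 2 ≤ P.real T := fun n =>
    (hnext (B n) _ hK ((Set.subset_iUnion (fun n => (B n).1) n).trans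
      Set.subset_union_left)).trans
      (measureReal_mono (Set.subset_iUnion (fun n => (B n).1) (n + 1)))
  have := le_of_tendsto' ((hlim.add_const (P.real (T ∪ R))).div_const 2) hge
  linarith

variable [NormedAddCommGroup E]

theorem stronglyMeasurable_glue {t : ℕ → Ω → E} (ht : ∀ j, StronglyMeasurable (t j)) {κ : Ω → ℕ}
    (hκ : Measurable κ) : StronglyMeasurable fun ω => t (κ ω) ω := by
  borelize E
  refine stronglyMeasurable_iff_measurable_separable.2 ⟨?_, ?_⟩
  · exact (measurable_from_prod_countable_right (f := fun p : ℕ × Ω => t p.1 p.2)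
      fun j => (ht j).measurable).comp (hκ.prodMk measurable_id)
  · refine (TopologicalSpace.IsSeparable.iUnion fun j => (ht j).isSeparable_range).mono ?_
    rintro _ ⟨ω, rfl⟩
    exact Set.mem_iUnion.2 ⟨κ ω, ω, rfl⟩

variable [NormedSpace ℝ E]

/-- Over an atomless measure, points of the convex hull of `A` are averages of `A`-valued
functions. -/
theorem Atomless.exists_setIntegral_eq [CompleteSpace E] {P : Measure Ω} [IsFiniteMeasure P]
    (hP : Atomless P) {A : Set E} {x : E} (hx : x ∈ convexHull ℝ A) {T : Set Ω}
    (hT : MeasurableSet T) :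
    ∃ t : Ω → E, StronglyMeasurable t ∧ (∀ ω, t ω ∈ A) ∧ Integrable t P ∧
      ∫ ω in T, t ω ∂P = P.real T • x := by
  classical
  -- Quantifying over all `T` makes `Q` convex: split `T` in proportion `a : b` and use the two
  -- points on the two parts.
  let Q : Set E := {x | ∀ T : Set Ω, MeasurableSet T → ∃ t : Ω → E, StronglyMeasurable t ∧
    (∀ ω, t ω ∈ A) ∧ Integrable t P ∧ ∫ ω in T, t ω ∂P = P.real T • x}
  have hQ : convexHull ℝ A ⊆ Q := by
    refine convexHull_min (fun a ha T _ => ⟨fun _ => a, stronglyMeasurable_const, fun _ => ha,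
      integrable_const a, setIntegral_const a⟩) ?_
    intro x hx y hy a b ha hb hab T hT
    obtain ⟨T₁, hT₁T, hT₁, hPT₁⟩ := hP.exists_measureReal_eq hT (c := a * P.real T)
      (by positivity) (mul_le_of_le_one_left measureReal_nonneg (by linarith))
    have hPd : P.real (T \ T₁) = b * P.real T := by
      rw [measureReal_sdiff hT₁T hT₁, hPT₁, eq_sub_of_add_eq' hab]
      ring
    obtain ⟨t, htm, htA, hti, ht⟩ := hx T₁ hT₁
    obtain ⟨s, hsm, hsA, hsi, hs⟩ := hy (T \ T₁) (hT.diff hT₁)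
    have hint : Integrable (T₁.piecewise t s) P :=
      Integrable.piecewise hT₁ hti.integrableOn hsi.integrableOn
    refine ⟨T₁.piecewise t s, htm.piecewise hT₁ hsm, fun ω => ?_, hint, ?_⟩
    · by_cases hω : ω ∈ T₁
      · simpa [hω] using htA ω
      · simpa [hω] using hsA ω
    · rw [← integral_inter_add_sdiff hT₁ hint.integrableOn, Set.inter_eq_self_of_subset_right hT₁T,
        setIntegral_congr_fun hT₁ (Set.piecewise_eqOn T₁ t s),
        setIntegral_congr_fun (hT.diff hT₁)
          ((Set.piecewise_eqOn_compl T₁ t s).mono fun ω hω => hω.2), ht, hs, hPT₁, hPd,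
        smul_add, smul_smul, smul_smul, mul_comm a, mul_comm b]
  exact hQ hx T hT

theorem integral_congr_fibers {P : Measure Ω} {f g : Ω → E} (hf : Integrable f P)
    (hg : Integrable g P) {κ : Ω → ℕ} (hκ : Measurable κ)
    (h : ∀ j, ∫ ω in κ ⁻¹' {j}, f ω ∂P = ∫ ω in κ ⁻¹' {j}, g ω ∂P) :
    ∫ ω, f ω ∂P = ∫ ω, g ω ∂P := by
  have hU : ⋃ j, κ ⁻¹' {j} = Set.univ := by
    ext ω
    simp
  have hm : ∀ j, MeasurableSet (κ ⁻¹' {j}) := fun j => hκ (measurableSet_singleton j)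
  have hd : Pairwise fun i j => Disjoint (κ ⁻¹' {i}) (κ ⁻¹' {j}) := fun i j hij =>
    Disjoint.preimage κ (Set.disjoint_singleton.2 hij)
  rw [← setIntegral_univ (μ := P) (f := f), ← setIntegral_univ (μ := P) (f := g), ← hU,
    integral_iUnion hm hd hf.integrableOn, integral_iUnion hm hd hg.integrableOn]
  exact tsum_congr h

theorem aumannIntegral_mono {P : Measure Ω} {F G : Ω → Set E} (h : ∀ ω, F ω ⊆ G ω) :
    aumannIntegral P F ⊆ aumannIntegral P G := by
  refine closure_mono ?_
  rintro _ ⟨f, hf, rfl⟩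
  exact ⟨f, ⟨hf.1, fun ω => h ω (hf.2 ω)⟩, rfl⟩

/-- A selector of `coBar F` is approximated by a countably-valued selector of the hulls of a nearby
`G m`. On each fiber its constant value is replaced by a function into `G m` with the same integral,
and the glued function is followed by a selector of `F`. -/
theorem MemL1.aumannIntegral_coBar [CompleteSpace E] {P : Measure Ω} [IsProbabilityMeasure P]
    (hP : Atomless P) {F : Ω → Set E} (hF : MemL1 P (BddClosedSets E) F) :
    aumannIntegral P (RandomSets.coBar F) = aumannIntegral P F := by
  refine (closure_minimal ?_ isClosed_closure).antisymm
    (aumannIntegral_mono fun ω => subset_closedConvexHull)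
  rintro _ ⟨f, hf, rfl⟩
  refine EMetric.mem_closure_iff.2 fun ε hε => ?_
  -- There are four losses of `δ`: the distance between `F` and `G m` is paid twice, and a selector
  -- is chosen twice.
  obtain ⟨δ, hδ0, hδ⟩ := ENNReal.lt_iff_exists_nnreal_btwn.1
    (ENNReal.div_pos hε.ne' (ENNReal.ofNat_ne_top (n := 4)))
  obtain ⟨G, hG, hlim⟩ := hF.stronglyMeasurable
  obtain ⟨m, hm⟩ := (hlim.eventually_le_const hδ0).exists
  obtain ⟨A, k, hA, hk, hGA⟩ := (hG m).exists_index
  have hGint : ∫⁻ ω, setNorm (G m ω) ∂P < ∞ :=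
    lintegral_setNorm_lt_top hF.integrable (hm.trans_lt ENNReal.coe_lt_top)
  have hae : ∀ᵐ ω ∂P, Metric.hausdorffEDist (G m ω) (F ω) ≤ δ :=
    (ae_hausdorffEDist_le P (G m) F).mono fun ω hω => hω.trans hm
  obtain ⟨x, κ, ρ, hκ, hρ, hxA, hd⟩ := exists_countable_selector hf.1.1.stronglyMeasurable_mk
    (A := fun i => convexHull ℝ (A i)) (fun i => (hA i).1.convexHull) hk hδ0.ne'
  choose t htm htA _ ht using fun j => hP.exists_setIntegral_eq (hxA j)
    (hκ (measurableSet_singleton j))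
  have htG : ∀ ω, t (κ ω) ω ∈ G m ω := fun ω => by
    have := htA (κ ω) ω
    rwa [hρ, ← congrFun hGA ω] at this
  have hti : Integrable (fun ω => t (κ ω) ω) P := integrable_of_mem hGint
    (stronglyMeasurable_glue htm hκ).aestronglyMeasurable htG
  have hxG : ∀ ω, x (κ ω) ∈ RandomSets.coBar (G m) ω := fun ω => by
    have := convexHull_subset_closedConvexHull (hxA (κ ω))
    rwa [hρ, ← congrFun hGA ω] at this
  have hxi : Integrable (fun ω => x (κ ω)) P := integrable_of_mem
    (by simpa only [RandomSets.coBar, setNorm_closedConvexHull] using hGint)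
    (stronglyMeasurable_comp_nat x hκ).aestronglyMeasurable hxG
  have heq : ∫ ω, x (κ ω) ∂P = ∫ ω, t (κ ω) ω ∂P := by
    refine integral_congr_fibers hxi hti hκ fun j => ?_
    have hj := hκ (measurableSet_singleton j)
    rw [setIntegral_congr_fun (g := fun _ => x j) hj fun ω (hω : κ ω = j) => by simp only [hω],
      setIntegral_congr_fun (f := fun ω => t (κ ω) ω) (g := t j) hj
        fun ω (hω : κ ω = j) => by simp only [hω],
      ht, setIntegral_const]
  have hfx : edist (∫ ω, f ω ∂P) (∫ ω, x (κ ω) ∂P) ≤ δ + δ := by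
    refine edist_integral_le_of_ae_edist_le hf.1 hxi ?_
    filter_upwards [hae, hf.1.1.ae_eq_mk] with ω h1 h2
    have h3 := hd ω
    rw [← h2, ← congrFun hGA ω] at h3
    refine h3.trans (add_le_add ?_ le_rfl)
    refine (infEDist_le_hausdorffEDist_of_mem_closedConvexHull (hf.2 ω)).trans ?_
    rwa [Metric.hausdorffEDist_comm]
  obtain ⟨f', hf', hd'⟩ := hF.exists_selector_integral hti (hae.mono fun ω hω =>
    (Metric.infEDist_le_hausdorffEDist_of_mem (htG ω)).trans hω) hδ0.ne' ENNReal.coe_ne_top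
  refine ⟨_, ⟨f', hf', rfl⟩, ?_⟩
  calc edist (∫ ω, f ω ∂P) (∫ ω, f' ω ∂P)
      ≤ edist (∫ ω, f ω ∂P) (∫ ω, x (κ ω) ∂P) + edist (∫ ω, x (κ ω) ∂P) (∫ ω, f' ω ∂P) :=
        edist_triangle _ _ _
    _ ≤ (δ + δ) + (δ + δ) := add_le_add hfx (heq ▸ hd')
    _ = 4 * δ := by ring
    _ < ε := ENNReal.mul_lt_of_lt_div' hδ

end

end RandomSets

theorem proposition5p6 {Ω E : Type*} [MeasurableSpace Ω] (P : Measure Ω) [IsProbabilityMeasure P]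
    [P.IsComplete] (hP : RandomSets.Atomless P)
    [NormedAddCommGroup E] [NormedSpace ℝ E] [CompleteSpace E]
    (F : Ω → Set E) (hF : RandomSets.MemL1 P (RandomSets.BddClosedSets E) F) :
    -- the closed convex hull of `F` is again a random set and has a Hukuhara integral
    RandomSets.MemL1 P (RandomSets.BddClosedConvexSets E) (RandomSets.coBar F) ∧
    RandomSets.IsHukuharaIntegral P (RandomSets.coBar F)
      (RandomSets.hukuharaIntegral P (RandomSets.coBar F)) ∧
    -- the Aumann integral of `F` is the Hukuhara integral of its closed convex hull
    RandomSets.aumannIntegral P F = RandomSets.hukuharaIntegral P (RandomSets.coBar F) ∧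
    -- consequences for the expectation
    RandomSets.expectation P F = RandomSets.hukuharaIntegral P (RandomSets.coBar F) ∧
    (RandomSets.expectation P F).Nonempty ∧ Bornology.IsBounded (RandomSets.expectation P F) ∧
    IsClosed (RandomSets.expectation P F) ∧ Convex ℝ (RandomSets.expectation P F) := by
  have hco := hF.coBar
  have hH := RandomSets.isHukuharaIntegral_aumannIntegral hco
  have hA := hF.aumannIntegral_coBar hP
  rw [hA] at hH
  have hmem := hH.1
  rw [RandomSets.expectation, hH.hukuharaIntegral_eq]
  exact ⟨hco, hH, rfl, rfl, hmem.1.1, hmem.1.2.2, hmem.1.2.1, hmem.2⟩
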